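/- Let $n$ be a positive integer, $[n]=\{1,\dots,n\}$, and let $h:[n]\to[n]$ be a Hessenberg function, i.e. $h(i)\ge i$ for all $i\in[n]$ and $h(i+1)\ge h(i)$ for $1\le i<n$. In $\mathcal R=\mathbb{Q}[x_1,\dots,x_n]$ put, for $1\le j\le i\le n$, $$f_{i,j}=\sum_{k=1}^{j}\Big(\prod_{\ell=j+1}^{i}(x_k-x_\ell)\Big)x_k,\qquad g_{i,j}=\sum_{k=1}^{j}\ \prod_{\ell=j+1}^{i}(x_k-x_\ell),$$ where empty products are $1$. Put $\mathsf p(h)=\min\{m\in[n] : h(m)=m\}$, and for $1\le s\le \mathsf p(h)$ let $$\mathcal A_s^h=\mathcal R/\langle g_{h(1),1},\dots,g_{h(s-1),s-1},f_{h(s),s},\dots,f_{h(n),n}\rangle .$$ Then for every integer $s$ with $1\le s\le \mathsf p(h)$ the images in $\mathcal A_s^h$ of the monomials $x_1^{i_1}\cdots x_n^{i_n}$ with $$0\le i_m\le h(m)-m-1\ \text{ for } 1\le m\le s-1,\qquad 0\le i_m\le h(m)-m\ \text{ for } s\le m\le n,$$ are pairwise distinct and form a basis of $\mathcal A_s^h$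 as a $\mathbb{Q}$-vector space. In particular (the case $s=1$), the images of the monomials $x_1^{i_1}\cdots x_n^{i_n}$ with $0\le i_m\le h(m)-m$ for all $1\le m\le n$ form a $\mathbb{Q}$-basis of $\mathcal R/I_h$, where $I_h=\langle f_{h(1),1},\dots,f_{h(n),n}\rangle$. -/

import Mathlib

namespace Hessenberg

open MvPolynomial

/- The set `[n] = {1, …, n}` is modelled by `Fin n`: the element `m : Fin n` stands for the number
`m + 1`. Differences such as `h(m) - m` do not change under this shift. -/

/-- `h : [n] → [n]` is a Hessenberg function: `h(i) ≥ i` for all `i`, and `h` is non-decreasing. -/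
structure IsHessenberg {n : ℕ} (h : Fin n → Fin n) : Prop where
  le_apply : ∀ i, i ≤ h i
  mono : Monotone h

/-- `f_{i,j} = ∑_{k=1}^{j} (∏_{ℓ=j+1}^{i} (x_k - x_ℓ)) x_k`, used for `j ≤ i`. -/
noncomputable def f {n : ℕ} (i j : Fin n) : MvPolynomial (Fin n) ℚ :=
  ∑ k ∈ Finset.Iic j, (∏ l ∈ Finset.Ioc j i, (X k - X l)) * X k

/-- `g_{i,j} = ∑_{k=1}^{j} ∏_{ℓ=j+1}^{i} (x_k - x_ℓ)`, used for `j ≤ i`. -/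
noncomputable def g {n : ℕ} (i j : Fin n) : MvPolynomial (Fin n) ℚ :=
  ∑ k ∈ Finset.Iic j, ∏ l ∈ Finset.Ioc j i, (X k - X l)

/-- The ideal `I_h = ⟨f_{h(1),1}, …, f_{h(n),n}⟩` of `ℚ[x_1, …, x_n]`. -/
noncomputable def idealI {n : ℕ} (h : Fin n → Fin n) : Ideal (MvPolynomial (Fin n) ℚ) :=
  Ideal.span (Set.range fun m => f (h m) m)

/-- The ideal `⟨g_{h(1),1}, …, g_{h(s-1),s-1}, f_{h(s),s}, …, f_{h(n),n}⟩`, where `s` is counted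
from `1`. -/
noncomputable def idealA {n : ℕ} (h : Fin n → Fin n) (s : ℕ) : Ideal (MvPolynomial (Fin n) ℚ) :=
  Ideal.span (Set.range fun m : Fin n => if (m : ℕ) + 1 < s then g (h m) m else f (h m) m)

/-- The ring `A_s^h = ℚ[x_1, …, x_n] / ⟨g_{h(1),1}, …, g_{h(s-1),s-1}, f_{h(s),s}, …, f_{h(n),n}⟩`. -/
abbrev A {n : ℕ} (h : Fin n → Fin n) (s : ℕ) : Type :=
  MvPolynomial (Fin n) ℚ ⧸ idealA h s

/-- `p(h) = min {m ∈ [n] | h(m) = m}`, counted from `1`. The set is non-empty for every Hessenberg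
function with `n ≥ 1`, because `h(n) = n`. -/
noncomputable def p {n : ℕ} (h : Fin n → Fin n) : ℕ :=
  sInf {k : ℕ | ∃ m : Fin n, h m = m ∧ k = (m : ℕ) + 1}

/-- The monomial `x_1^{e_1} ⋯ x_n^{e_n}`. -/
noncomputable def xpow {n : ℕ} (e : Fin n → ℕ) : MvPolynomial (Fin n) ℚ :=
  ∏ m, X m ^ e m

/-- The exponent vectors with `0 ≤ e_m ≤ h(m) - m - 1` for `m < s` and `0 ≤ e_m ≤ h(m) - m` for
`m ≥ s`, with the subtractions in `ℤ`. -/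
def exponents {n : ℕ} (h : Fin n → Fin n) (s : ℕ) : Set (Fin n → ℕ) :=
  {e | ∀ m : Fin n,
    ((m : ℕ) + 1 < s → (e m : ℤ) ≤ ((h m : ℕ) : ℤ) - ((m : ℕ) : ℤ) - 1) ∧
    (s ≤ (m : ℕ) + 1 → (e m : ℤ) ≤ ((h m : ℕ) : ℤ) - ((m : ℕ) : ℤ))}

end Hessenberg

/-!
Setting one variable to zero shows that the monomials span, and a degree count shows that spanning
monomials of this kind are independent.

**Spanning.** Since `f_{i,j} = x_j g_{i,j} + g_{i,j-1}`, and `g_{i,j}` with `i ≥ h(j)` lies in the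
ideal of the `g_{h(m),m}` with `m ≤ j`, the element `f_{h(s),s}` is equal to `x_s g_{h(s),s}` modulo
the earlier generators (`f_sub_X_mul_g_mem`). Hence multiplication by `x_s` induces a map
`A_{s+1}^h → A_s^h`. Its cokernel is `A_s^h / (x_s)`, and setting `x_s = 0` turns the remaining
generators into those of an algebra `A_{s'}^{h'}` in one variable less (`killVar_gen`): a generator
`g_{h(m),m}` with `m < s ≤ h(m)` becomes `f_{h(m)-1,m}`, and the other generators keep their type.
The reduced monomials for `A_s^h` are those of `A_{s'}^{h'}`, which do not involve `x_s`, and `x_s`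
times those of `A_{s+1}^h`. So they span by induction (`exists_sub_mem_idealA`). The induction on
`s` starts at an algebra which is zero because its last generator `g_{n,n} = n` is a unit.

**Independence.** Let `F_m` be homogeneous polynomials of degrees `d_m > 0`, as many as there are
variables, such that the monomials with exponents `e_m < d_m` span modulo the ideal of the `F_m`.
Division with remainder of the exponents by the `d_m` defines a degree-preserving linear map
`∏ x_m ^ (q_m d_m + r_m) ↦ ∏ x_m ^ r_m F_m ^ q_m` from the polynomial ring to itself. Spanning makes
it surjective (`expansion_surjective`), and as the homogeneous components are finite-dimensional it
is bijective. It fixes the reduced monomials and turns multiplication by `x_m ^ d_m` into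
multiplication by `F_m`. So a combination of reduced monomials in the ideal of the `F_m` is also in
the ideal of the `x_m ^ d_m`, and vanishes (`eq_zero_of_mem_reducedSpan_of_mem_ideal`). The
condition `s ≤ p(h)` ensures that the degrees of the generators of the ideal are positive.
-/

namespace Hessenberg

open MvPolynomial

/-! ### Bases of quotients by homogeneous polynomials -/

section Expansion

variable {σ K : Type*} [Field K]

/-- The degree `k` part of a multiple `a F_m` is again a multiple of `F_m`, by a polynomial of
smaller degree. -/
lemma exists_homogeneousComponent_mul {P : MvPolynomial σ K} {e : ℕ} (he : 0 < e)
    (hP : P.IsHomogeneous e) (a : MvPolynomial σ K) (k : ℕ) :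
    ∃ b, homogeneousComponent k (a * P) = P * b ∧ (b = 0 ∨ ∃ j < k, b.IsHomogeneous j) := by
  have key (i : ℕ) : homogeneousComponent k (homogeneousComponent i a * P) =
      if k = i + e then homogeneousComponent i a * P else 0 :=
    homogeneousComponent_of_mem ((homogeneousComponent_isHomogeneous i a).mul hP)
  have hsum : homogeneousComponent k (a * P) =
      ∑ i ∈ Finset.range (a.totalDegree + 1),
        if k = i + e then homogeneousComponent i a * P else 0 := by
    conv_lhs => rw [← sum_homogeneousComponent a, Finset.sum_mul, map_sum]
    exact Finset.sum_congr rfl fun i _ => key i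
  rw [hsum]
  by_cases hk : e ≤ k
  · refine ⟨homogeneousComponent (k - e) a, ?_,
      Or.inr ⟨k - e, by omega, homogeneousComponent_isHomogeneous _ _⟩⟩
    rw [mul_comm P]
    by_cases hi : k - e < a.totalDegree + 1
    · rw [Finset.sum_eq_single_of_mem (k - e) (Finset.mem_range.2 hi), if_pos (by omega)]
      intro i _ hne
      rw [if_neg (by omega)]
    · rw [homogeneousComponent_eq_zero (k - e) a (by omega), zero_mul]
      refine Finset.sum_eq_zero fun i hi' => ?_
      rw [Finset.mem_range] at hi'
      rw [if_neg (by omega)]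
  · refine ⟨0, ?_, Or.inl rfl⟩
    rw [mul_zero]
    refine Finset.sum_eq_zero fun i _ => ?_
    rw [if_neg (by omega)]

/-- The `K`-span of the monomials `x ^ e` with `e_m < d_m` for all `m`. -/
noncomputable def reducedSpan (K : Type*) [Field K] (d : σ → ℕ) :
    Submodule K (MvPolynomial σ K) :=
  Submodule.span K {q | ∃ β : σ →₀ ℕ, (∀ m, β m < d m) ∧ q = monomial β 1}

lemma homogeneousComponent_mem_reducedSpan {d : σ → ℕ} {p : MvPolynomial σ K}
    (hp : p ∈ reducedSpan K d) (k : ℕ) :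
    homogeneousComponent k p ∈ reducedSpan K d := by
  induction hp using Submodule.span_induction with
  | mem x hx =>
    obtain ⟨β, hβ, rfl⟩ := hx
    rw [homogeneousComponent_of_mem (isHomogeneous_monomial (1 : K) rfl)]
    split_ifs
    · exact Submodule.subset_span ⟨β, hβ, rfl⟩
    · exact zero_mem _
  | zero => simp
  | add x y _ _ hx hy => rw [map_add]; exact add_mem hx hy
  | smul c x _ hx => rw [map_smul]; exact Submodule.smul_mem _ _ hx

lemma lt_of_coeff_ne_zero_of_mem_reducedSpan {d : σ → ℕ} {p : MvPolynomial σ K}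
    (hp : p ∈ reducedSpan K d) : ∀ β : σ →₀ ℕ, p.coeff β ≠ 0 → ∀ m, β m < d m := by
  induction hp using Submodule.span_induction with
  | mem x hx =>
    obtain ⟨γ, hγ, rfl⟩ := hx
    classical
    intro β hβ
    rw [coeff_monomial] at hβ
    obtain rfl : γ = β := by by_contra h; simp [h] at hβ
    exact hγ
  | zero => simp
  | add x y _ _ hx hy =>
    intro β hβ
    by_cases h : x.coeff β = 0
    · exact hy β (by rwa [coeff_add, h, zero_add] at hβ)
    · exact hx β h
  | smul c x _ hx =>
    intro β hβ
    exact hx β fun h => hβ (by rw [coeff_smul, h, smul_zero])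

variable [Fintype σ]

/-- The linear endomorphism of `K[x_σ]` which sends `∏ x_m ^ (q_m d_m + r_m)`, `0 ≤ r_m < d_m`, to
`∏ x_m ^ r_m F_m ^ q_m`. It is bijective exactly when these products form a `K`-basis. -/
noncomputable def expansion (F : σ → MvPolynomial σ K) (d : σ → ℕ) :
    MvPolynomial σ K →ₗ[K] MvPolynomial σ K :=
  (basisMonomials σ K).constr K fun β => ∏ m, (X m ^ (β m % d m) * F m ^ (β m / d m))

variable {F : σ → MvPolynomial σ K} {d : σ → ℕ}

lemma expansion_monomial (β : σ →₀ ℕ) :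
    expansion F d (monomial β 1) = ∏ m, (X m ^ (β m % d m) * F m ^ (β m / d m)) := by
  have := (basisMonomials σ K).constr_basis K
    (fun β => ∏ m, (X m ^ (β m % d m) * F m ^ (β m / d m))) β
  rwa [coe_basisMonomials] at this

lemma expansion_monomial_of_lt {β : σ →₀ ℕ} (hβ : ∀ m, β m < d m) :
    expansion F d (monomial β 1) = monomial β 1 := by
  rw [expansion_monomial, monomial_eq, Finsupp.prod_fintype _ _ (by simp), C_1, one_mul]
  refine Finset.prod_congr rfl fun m _ => ?_
  rw [Nat.mod_eq_of_lt (hβ m), Nat.div_eq_of_lt (hβ m), pow_zero, mul_one]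

lemma expansion_X_pow_mul (hd : ∀ m, 0 < d m) (m : σ) (p : MvPolynomial σ K) :
    expansion F d (X m ^ d m * p) = F m * expansion F d p := by
  classical
  suffices H : (expansion F d) ∘ₗ LinearMap.mulLeft K (X m ^ d m) =
      LinearMap.mulLeft K (F m) ∘ₗ expansion F d from LinearMap.congr_fun H p
  refine (basisMonomials σ K).ext fun β => ?_
  have hmul : (X m ^ d m * monomial β 1 : MvPolynomial σ K) =
      monomial (Finsupp.single m (d m) + β) 1 := by
    rw [X_pow_eq_monomial, monomial_mul, one_mul]
  simp only [coe_basisMonomials, LinearMap.comp_apply, LinearMap.mulLeft_apply, hmul,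
    expansion_monomial]
  rw [← Finset.mul_prod_erase _ _ (Finset.mem_univ m),
    ← Finset.mul_prod_erase _ (fun m => X m ^ (β m % d m) * F m ^ (β m / d m))
      (Finset.mem_univ m), ← mul_assoc]
  congr 1
  · simp only [Finsupp.add_apply, Finsupp.single_eq_same]
    rw [Nat.add_mod_left, Nat.add_div_left _ (hd m), pow_succ]
    ring
  · refine Finset.prod_congr rfl fun l hl => ?_
    rw [Finsupp.add_apply, Finsupp.single_eq_of_ne (Finset.ne_of_mem_erase hl), zero_add]

lemma isHomogeneous_expansion_monomial (hF : ∀ m, (F m).IsHomogeneous (d m)) (β : σ →₀ ℕ) :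
    (expansion F d (monomial β 1)).IsHomogeneous β.degree := by
  rw [expansion_monomial, Finsupp.degree_eq_sum]
  refine IsHomogeneous.prod _ _ _ fun m _ => ?_
  have := ((isHomogeneous_X K m).pow (β m % d m)).mul ((hF m).pow (β m / d m))
  rwa [one_mul, Nat.mod_add_div] at this

lemma homogeneousComponent_expansion (hF : ∀ m, (F m).IsHomogeneous (d m)) (k : ℕ)
    (p : MvPolynomial σ K) :
    homogeneousComponent k (expansion F d p) = expansion F d (homogeneousComponent k p) := by
  suffices H : homogeneousComponent k ∘ₗ expansion F d =
      expansion F d ∘ₗ homogeneousComponent k from LinearMap.congr_fun H p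
  refine (basisMonomials σ K).ext fun β => ?_
  simp only [coe_basisMonomials, LinearMap.comp_apply]
  rw [homogeneousComponent_of_mem (isHomogeneous_expansion_monomial hF β),
    homogeneousComponent_of_mem (isHomogeneous_monomial (1 : K) rfl)]
  split_ifs <;> simp

lemma expansion_of_mem_reducedSpan {p : MvPolynomial σ K} (hp : p ∈ reducedSpan K d) :
    expansion F d p = p := by
  induction hp using Submodule.span_induction with
  | mem x hx =>
    obtain ⟨β, hβ, rfl⟩ := hx
    exact expansion_monomial_of_lt hβ
  | zero => exact map_zero _
  | add x y _ _ hx hy => rw [map_add, hx, hy]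
  | smul c x _ hx => rw [map_smul, hx]

/-- If the reduced monomials span modulo the ideal of the `F_m`, then repeated reduction, which
terminates because it lowers the degree of the coefficients, writes every polynomial as a
combination of products of reduced monomials and powers of the `F_m`. -/
lemma expansion_surjective (hd : ∀ m, 0 < d m) (hF : ∀ m, (F m).IsHomogeneous (d m))
    (hspan : ∀ q : MvPolynomial σ K, ∃ r ∈ reducedSpan K d, q - r ∈ Ideal.span (Set.range F)) :
    Function.Surjective (expansion F d) := by
  have hom (k : ℕ) : ∀ q : MvPolynomial σ K, q.IsHomogeneous k →
      q ∈ LinearMap.range (expansion F d) := by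
    induction k using Nat.strong_induction_on with
    | _ k ih =>
      intro q hq
      obtain ⟨r, hr, hqr⟩ := hspan q
      obtain ⟨a, ha⟩ := (Ideal.mem_span_range_iff_exists_fun).1 hqr
      have hq' : q = homogeneousComponent k r + ∑ m, homogeneousComponent k (a m * F m) := by
        rw [← map_sum, ha, ← map_add, add_sub_cancel, homogeneousComponent_eq_self hq]
      rw [hq']
      refine add_mem ⟨_, expansion_of_mem_reducedSpan
        (homogeneousComponent_mem_reducedSpan hr k)⟩ (sum_mem fun m _ => ?_)
      obtain ⟨b, hb, hb0 | ⟨j, hj, hbj⟩⟩ :=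
        exists_homogeneousComponent_mul (hd m) (hF m) (a m) k
      · rw [hb, hb0, mul_zero]
        exact zero_mem _
      · obtain ⟨c, rfl⟩ := ih j hj b hbj
        exact ⟨X m ^ d m * c, by rw [expansion_X_pow_mul hd, hb]⟩
  intro q
  rw [← LinearMap.mem_range, ← sum_homogeneousComponent q]
  exact sum_mem fun i _ => hom i _ (homogeneousComponent_isHomogeneous i q)

/-- A surjective degree-preserving endomorphism is injective, since the homogeneous components are
finite-dimensional. -/
lemma expansion_injective (hF : ∀ m, (F m).IsHomogeneous (d m))
    (hsurj : Function.Surjective (expansion F d)) : Function.Injective (expansion F d) := by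
  have hmaps (k : ℕ) : ∀ p ∈ homogeneousSubmodule σ K k,
      expansion F d p ∈ homogeneousSubmodule σ K k := fun p hp => by
    rw [← homogeneousComponent_eq_self hp, ← homogeneousComponent_expansion hF]
    exact homogeneousComponent_isHomogeneous _ _
  have hinj (k : ℕ) : Function.Injective ((expansion F d).restrict (hmaps k)) := by
    have : FiniteDimensional K (homogeneousSubmodule σ K k) :=
      Module.Finite.iff_fg.2 (homogeneousSubmodule_fg _ _ k)
    rw [LinearMap.injective_iff_surjective]
    rintro ⟨q, hq⟩
    obtain ⟨p, rfl⟩ := hsurj q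
    refine ⟨⟨homogeneousComponent k p, homogeneousComponent_isHomogeneous _ _⟩, Subtype.ext ?_⟩
    simp only [LinearMap.restrict_apply]
    rw [← homogeneousComponent_expansion hF, homogeneousComponent_eq_self hq]
  rw [injective_iff_map_eq_zero]
  intro p hp
  rw [← sum_homogeneousComponent p]
  refine Finset.sum_eq_zero fun k _ => ?_
  have h0 : (expansion F d).restrict (hmaps k)
      ⟨homogeneousComponent k p, homogeneousComponent_isHomogeneous _ _⟩ = 0 := by
    refine Subtype.ext ?_
    simp only [LinearMap.restrict_apply]
    rw [← homogeneousComponent_expansion hF, hp, map_zero]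
    rfl
  exact congrArg Subtype.val ((injective_iff_map_eq_zero _).1 (hinj k) _ h0)

/-- If the reduced monomials span modulo the ideal of the `F_m`, then they are independent modulo
it: by injectivity of `expansion` a combination of reduced monomials in the ideal is equal to one
of monomials divisible by some `x_m ^ d_m`. -/
lemma eq_zero_of_mem_reducedSpan_of_mem_ideal (hd : ∀ m, 0 < d m)
    (hF : ∀ m, (F m).IsHomogeneous (d m))
    (hspan : ∀ q : MvPolynomial σ K, ∃ r ∈ reducedSpan K d, q - r ∈ Ideal.span (Set.range F))
    {p : MvPolynomial σ K} (hp : p ∈ reducedSpan K d) (hpF : p ∈ Ideal.span (Set.range F)) :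
    p = 0 := by
  have hsurj := expansion_surjective hd hF hspan
  have hinj := expansion_injective hF hsurj
  obtain ⟨a, ha⟩ := (Ideal.mem_span_range_iff_exists_fun).1 hpF
  choose b hb using fun m => hsurj (a m)
  have hpb : p = ∑ m, X m ^ d m * b m := by
    apply hinj
    rw [expansion_of_mem_reducedSpan hp, map_sum, ← ha]
    refine Finset.sum_congr rfl fun m _ => ?_
    rw [expansion_X_pow_mul hd, hb, mul_comm]
  ext β
  rw [coeff_zero]
  by_contra hβ
  have hlt := lt_of_coeff_ne_zero_of_mem_reducedSpan hp β hβ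
  apply hβ
  rw [hpb, coeff_sum]
  refine Finset.sum_eq_zero fun m _ => ?_
  classical
  rw [X_pow_eq_monomial, coeff_monomial_mul', if_neg]
  intro hle
  have := hle m
  rw [Finsupp.single_eq_same] at this
  exact absurd (hlt m) (not_lt.2 this)

end Expansion

/-! ### Recurrences for the polynomials `f` and `g` -/

section Recurrence

/-- `∑_{k < j} ∏_{j ≤ l < i} (x_k - x_l)` for a sequence `x` in a commutative ring. In contrast to
`g`, the second index is the number of summands, so that it may be `0`. -/
def gSeq {R : Type*} [CommRing R] (x : ℕ → R) (i j : ℕ) : R :=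
  ∑ k ∈ Finset.range j, ∏ l ∈ Finset.Ico j i, (x k - x l)

variable {R : Type*} [CommRing R] (x : ℕ → R)

lemma gSeq_zero (i : ℕ) : gSeq x i 0 = 0 := by simp [gSeq]

lemma sum_sub_mul_prod_eq_gSeq {i j : ℕ} (hij : j < i) :
    ∑ k ∈ Finset.range (j + 1), (x k - x j) * ∏ l ∈ Finset.Ico (j + 1) i, (x k - x l) =
      gSeq x i j := by
  rw [Finset.sum_range_succ, sub_self, zero_mul, add_zero]
  exact Finset.sum_congr rfl fun k _ =>
    (Finset.prod_eq_prod_Ico_succ_bot hij fun l => x k - x l).symm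

lemma gSeq_succ_succ {i j : ℕ} (hij : j < i) :
    gSeq x (i + 1) (j + 1) = gSeq x i j + (x j - x i) * gSeq x i (j + 1) := by
  rw [← sum_sub_mul_prod_eq_gSeq x hij, gSeq, gSeq, Finset.mul_sum, ← Finset.sum_add_distrib]
  refine Finset.sum_congr rfl fun k _ => ?_
  rw [Finset.prod_Ico_succ_top (by omega)]
  ring

/-- The sequence of variables `x_0, …, x_{n-1}`, continued by `0`. -/
noncomputable def varSeq (n : ℕ) (k : ℕ) : MvPolynomial (Fin n) ℚ :=
  if hk : k < n then X ⟨k, hk⟩ else 0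

lemma varSeq_val {n : ℕ} (k : Fin n) : varSeq n k = X k := by simp [varSeq]

variable {n : ℕ}

lemma map_valEmbedding_Iic (j : Fin n) :
    (Finset.Iic j).map Fin.valEmbedding = Finset.range (j + 1) := by
  rw [Fin.map_valEmbedding_Iic, Nat.range_succ_eq_Iic]

lemma map_valEmbedding_Ioc (j i : Fin n) :
    (Finset.Ioc j i).map Fin.valEmbedding = Finset.Ico (j + 1 : ℕ) (i + 1) := by
  rw [Fin.map_valEmbedding_Ioc]
  ext l
  simp only [Finset.mem_Ioc, Finset.mem_Ico]
  omega

lemma g_eq_gSeq (i j : Fin n) : g i j = gSeq (varSeq n) (i + 1) (j + 1) := by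
  simp only [g, gSeq, ← map_valEmbedding_Iic, ← map_valEmbedding_Ioc, Finset.sum_map,
    Finset.prod_map, Fin.valEmbedding_apply, varSeq_val]

lemma f_eq_X_mul_g_add {i j : Fin n} (hij : j ≤ i) :
    f i j = X j * g i j + gSeq (varSeq n) (i + 1) j := by
  rw [← sum_sub_mul_prod_eq_gSeq _ (Nat.lt_succ_of_le hij)]
  simp only [f, g, ← map_valEmbedding_Iic, ← map_valEmbedding_Ioc, Finset.sum_map,
    Finset.prod_map, Fin.valEmbedding_apply, varSeq_val, Finset.mul_sum]
  rw [← Finset.sum_add_distrib]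
  refine Finset.sum_congr rfl fun k _ => ?_
  ring

/-- The polynomials `g_{i,j}` with `i ≥ h(j)` lie in the ideal of the `g_{h(m),m}` with `m ≤ j`. -/
lemma gSeq_mem_ideal {h : Fin n → Fin n} (hh : IsHessenberg h) {J : Ideal (MvPolynomial (Fin n) ℚ)}
    {s : ℕ} (hJ : ∀ m : Fin n, (m : ℕ) < s → g (h m) m ∈ J) (j : ℕ) (hj : j < n) (hjs : j < s) :
    ∀ i, (h ⟨j, hj⟩ : ℕ) + 1 ≤ i → gSeq (varSeq n) i (j + 1) ∈ J := by
  induction j with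
  | zero =>
    intro i hi
    induction i, hi using Nat.le_induction with
    | base =>
      have := hJ ⟨0, hj⟩ hjs
      rwa [g_eq_gSeq] at this
    | succ i hi ih =>
      rw [gSeq_succ_succ _ (by omega), gSeq_zero, zero_add]
      exact Ideal.mul_mem_left _ _ ih
  | succ j ihj =>
    intro i hi
    have hle : j + 1 ≤ (h ⟨j + 1, hj⟩ : ℕ) := hh.le_apply ⟨j + 1, hj⟩
    have hmono : (h ⟨j, by omega⟩ : ℕ) ≤ h ⟨j + 1, hj⟩ := hh.mono (Fin.mk_le_mk.2 (by omega))
    induction i, hi using Nat.le_induction with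
    | base =>
      have := hJ ⟨j + 1, hj⟩ hjs
      rwa [g_eq_gSeq] at this
    | succ i hi ih =>
      rw [gSeq_succ_succ _ (by omega)]
      exact add_mem (ihj (by omega) (by omega) i (by omega)) (Ideal.mul_mem_left _ _ (ih hmono))

/-- Modulo the `g_{h(m),m}` with `m < s`, the polynomial `f_{h(s),s}` is `x_s g_{h(s),s}`. -/
lemma f_sub_X_mul_g_mem {h : Fin n → Fin n} (hh : IsHessenberg h)
    {J : Ideal (MvPolynomial (Fin n) ℚ)} (s : Fin n)
    (hJ : ∀ m : Fin n, (m : ℕ) < s → g (h m) m ∈ J) : f (h s) s - X s * g (h s) s ∈ J := by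
  rw [f_eq_X_mul_g_add (hh.le_apply s), add_sub_cancel_left]
  obtain ⟨s, hs⟩ := s
  cases s with
  | zero =>
    rw [gSeq_zero]
    exact zero_mem _
  | succ t =>
    have hmono : (h ⟨t, by omega⟩ : ℕ) ≤ h ⟨t + 1, hs⟩ := hh.mono (Fin.mk_le_mk.2 (by omega))
    exact gSeq_mem_ideal hh hJ t (by omega) (Nat.lt_succ_self t) _ (by omega)

end Recurrence

/-! ### Setting one variable to zero -/

section Specialization

variable {n : ℕ}

/-- The specialization `x_s = 0`, followed by a relabelling of the other variables in their
order. -/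
noncomputable def killVar (s : Fin (n + 1)) :
    MvPolynomial (Fin (n + 1)) ℚ →ₐ[ℚ] MvPolynomial (Fin n) ℚ :=
  aeval (s.insertNth (α := fun _ => MvPolynomial (Fin n) ℚ) 0 X)

lemma killVar_X_self (s : Fin (n + 1)) : killVar s (X s) = 0 := by
  rw [killVar, aeval_X, Fin.insertNth_apply_same]

lemma killVar_X_succAbove (s : Fin (n + 1)) (k : Fin n) :
    killVar s (X (s.succAbove k)) = X k := by
  rw [killVar, aeval_X, Fin.insertNth_apply_succAbove]

lemma exists_eq_rename_killVar_add (s : Fin (n + 1)) (q : MvPolynomial (Fin (n + 1)) ℚ) :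
    ∃ r, q = rename s.succAbove (killVar s q) + X s * r := by
  have H : Ideal.Quotient.mkₐ ℚ (Ideal.span {(X s : MvPolynomial (Fin (n + 1)) ℚ)}) =
      (Ideal.Quotient.mkₐ ℚ (Ideal.span {X s})).comp
        ((rename s.succAbove).comp (killVar s)) := by
    refine algHom_ext fun k => ?_
    rcases Fin.eq_self_or_eq_succAbove s k with rfl | ⟨k, rfl⟩
    · simp [killVar_X_self]
    · simp [killVar_X_succAbove]
  have hq := DFunLike.congr_fun H q
  simp only [AlgHom.comp_apply, Ideal.Quotient.mkₐ_eq_mk, Ideal.Quotient.eq,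
    Ideal.mem_span_singleton] at hq
  obtain ⟨r, hr⟩ := hq
  exact ⟨r, by rw [← hr]; ring⟩

lemma sum_Iic_succAbove {M : Type*} [AddCommMonoid M] (s : Fin (n + 1)) (j : Fin n)
    (G : Fin (n + 1) → M) :
    ∑ k ∈ Finset.Iic (s.succAbove j), G k =
      (if s ≤ s.succAbove j then G s else 0) + ∑ k ∈ Finset.Iic j, G (s.succAbove k) := by
  rw [← Finset.filter_ge_eq_Iic, ← Finset.filter_ge_eq_Iic, Finset.sum_filter, Finset.sum_filter,
    Fin.sum_univ_succAbove _ s]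
  simp only [Fin.succAbove_le_succAbove_iff]

lemma prod_Ioc_succAbove {M : Type*} [CommMonoid M] {s i : Fin (n + 1)} {i' : Fin n} (j : Fin n)
    (hi : ∀ l, s.succAbove l ≤ i ↔ l ≤ i') (G : Fin (n + 1) → M) :
    ∏ l ∈ Finset.Ioc (s.succAbove j) i, G l =
      (if s.succAbove j < s ∧ s ≤ i then G s else 1) * ∏ l ∈ Finset.Ioc j i', G (s.succAbove l) := by
  rw [← Finset.filter_lt_le_eq_Ioc, ← Finset.filter_lt_le_eq_Ioc, Finset.prod_filter,
    Finset.prod_filter, Fin.prod_univ_succAbove _ s]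
  simp only [Fin.succAbove_lt_succAbove_iff, hi]

variable {s i : Fin (n + 1)} {i' j : Fin n}

lemma killVar_g_of_le (hi : ∀ l, s.succAbove l ≤ i ↔ l ≤ i') (hj : s.succAbove j < s)
    (hsi : s ≤ i) : killVar s (g i (s.succAbove j)) = f i' j := by
  rw [g, sum_Iic_succAbove, if_neg (not_le.2 hj), zero_add, map_sum, f]
  refine Finset.sum_congr rfl fun k _ => ?_
  rw [prod_Ioc_succAbove j hi, if_pos ⟨hj, hsi⟩, map_mul, map_prod]
  simp only [map_sub, killVar_X_self, killVar_X_succAbove, sub_zero]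
  rw [mul_comm]

lemma killVar_g_of_lt (hi : ∀ l, s.succAbove l ≤ i ↔ l ≤ i') (hj : s.succAbove j < s)
    (hsi : i < s) : killVar s (g i (s.succAbove j)) = g i' j := by
  rw [g, sum_Iic_succAbove, if_neg (not_le.2 hj), zero_add, map_sum, g]
  refine Finset.sum_congr rfl fun k _ => ?_
  rw [prod_Ioc_succAbove j hi, if_neg fun H => not_le.2 hsi H.2, one_mul, map_prod]
  simp only [map_sub, killVar_X_succAbove]

lemma killVar_f (hi : ∀ l, s.succAbove l ≤ i ↔ l ≤ i') (hj : s < s.succAbove j) :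
    killVar s (f i (s.succAbove j)) = f i' j := by
  rw [f, sum_Iic_succAbove, if_pos hj.le, map_add, map_mul, killVar_X_self, mul_zero, zero_add,
    map_sum, f]
  refine Finset.sum_congr rfl fun k _ => ?_
  rw [prod_Ioc_succAbove j hi, if_neg fun H => hj.not_gt H.1, one_mul, map_mul, map_prod]
  simp only [map_sub, killVar_X_succAbove]

end Specialization

/-! ### Spanning by the reduced monomials -/

/-! The index `s : Fin (n + 1)` of a variable is counted from `0`, so that the generators of
`idealA h (s + 1)` are of type `g` before `s` and of type `f` from `s` on. -/

section Spanning

/-- The degree of the `m`-th generator of `idealA h s`, which is also the number of exponents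
allowed for `x_m`. The truncated subtraction is the true one because `h m ≥ m`. -/
def genDegree {n : ℕ} (h : Fin n → Fin n) (s : ℕ) (m : Fin n) : ℕ :=
  if (m : ℕ) + 1 < s then (h m : ℕ) - m else (h m : ℕ) - m + 1

/-- The `m`-th generator of `idealA h s`. -/
noncomputable def gen {n : ℕ} (h : Fin n → Fin n) (s : ℕ) (m : Fin n) : MvPolynomial (Fin n) ℚ :=
  if (m : ℕ) + 1 < s then g (h m) m else f (h m) m

lemma gen_mem_idealA {n : ℕ} (h : Fin n → Fin n) (s : ℕ) (m : Fin n) : gen h s m ∈ idealA h s :=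
  Ideal.subset_span ⟨m, rfl⟩

/-- If `h(m) = m` for some `m < s`, then `g_{m,m} = m` is a unit. -/
lemma idealA_eq_top {n : ℕ} {h : Fin n → Fin n} {s : ℕ} {m : Fin n} (hms : (m : ℕ) + 1 < s)
    (hm : h m = m) : idealA h s = ⊤ := by
  have hmem := gen_mem_idealA h s m
  rw [gen, if_pos hms, hm, g] at hmem
  simp only [Finset.Ioc_self, Finset.prod_empty, Finset.sum_const, Fin.card_Iic, nsmul_eq_mul,
    mul_one] at hmem
  refine Ideal.eq_top_of_isUnit_mem _ hmem ?_
  rw [← map_natCast (C : ℚ →+* MvPolynomial (Fin n) ℚ)]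
  exact (IsUnit.mk0 ((m + 1 : ℕ) : ℚ) (Nat.cast_ne_zero.2 (Nat.succ_ne_zero _))).map C

variable {n : ℕ}

/-- The Hessenberg function on `[n+1] ∖ {s}`, relabelled by `[n]`, which sends `m` to the largest
element `≤ h(m)` other than `s`. -/
lemma exists_delete {h : Fin (n + 1) → Fin (n + 1)} (hh : IsHessenberg h) (s : Fin (n + 1)) :
    ∃ h' : Fin n → Fin n, IsHessenberg h' ∧
      (∀ j, (h' j : ℕ) =
        if h (s.succAbove j) < s then (h (s.succAbove j) : ℕ) else h (s.succAbove j) - 1) ∧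
      ∀ j l, s.succAbove l ≤ h (s.succAbove j) ↔ l ≤ h' j := by
  have key (j : Fin n) : ∃ i' : Fin n,
      (i' : ℕ) =
        (if h (s.succAbove j) < s then (h (s.succAbove j) : ℕ) else h (s.succAbove j) - 1) ∧
      ∀ l, s.succAbove l ≤ h (s.succAbove j) ↔ l ≤ i' := by
    have hle := hh.le_apply (s.succAbove j)
    refine ⟨⟨if h (s.succAbove j) < s then (h (s.succAbove j) : ℕ) else h (s.succAbove j) - 1,
      ?_⟩, rfl, fun l => ?_⟩
    · split_ifs with hlt
      · have := s.isLt
        rw [Fin.lt_def] at hlt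
        omega
      · have := (h (s.succAbove j)).isLt
        have := j.isLt
        omega
    · rw [Fin.le_def (a := l)]
      simp only
      generalize h (s.succAbove j) = i at hle ⊢
      simp only [Fin.succAbove, Fin.lt_def, Fin.le_def, Fin.val_castSucc] at hle ⊢
      split_ifs at hle ⊢ <;> simp only [Fin.val_castSucc, Fin.val_succ] at hle ⊢ <;> omega
  choose h' hval hiff using key
  refine ⟨h', ⟨fun j => (hiff j j).1 (hh.le_apply _), fun j k hjk => ?_⟩, hval, hiff⟩
  exact (hiff k _).1 (((hiff j _).2 le_rfl).trans
    (hh.mono (Fin.succAbove_le_succAbove_iff.2 hjk)))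

/-- An initial segment of `[n]` is given by a bound. -/
lemma exists_bound_of_isLowerSet {P : Fin n → Prop} (hP : ∀ j k, j ≤ k → P k → P j) :
    ∃ t : ℕ, ∀ j : Fin n, (j : ℕ) < t ↔ P j := by
  classical
  have hex : ∃ t : ℕ, ∀ j : Fin n, P j → (j : ℕ) < t := ⟨n, fun j _ => j.isLt⟩
  refine ⟨Nat.find hex, fun j => ⟨fun hj => ?_, Nat.find_spec hex j⟩⟩
  by_contra hPj
  refine Nat.find_min hex hj fun k hk => ?_
  by_contra hjk
  exact hPj (hP j k (not_lt.1 hjk) hk)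

variable {h : Fin (n + 1) → Fin (n + 1)} {s : Fin (n + 1)} {h' : Fin n → Fin n} {t : ℕ}

/-- Setting `x_s = 0` in the generators of `idealA h (s + 1)` other than `f_{h(s),s}` gives the
generators of an ideal of the same kind in one variable less. -/
lemma killVar_gen (hiff : ∀ j l, s.succAbove l ≤ h (s.succAbove j) ↔ l ≤ h' j)
    (ht : ∀ j : Fin n, (j : ℕ) < t ↔ s.succAbove j < s ∧ h (s.succAbove j) < s) (j : Fin n) :
    killVar s (gen h (s + 1) (s.succAbove j)) = gen h' (t + 1) j := by
  have ht' := ht j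
  rcases lt_or_gt_of_ne (Fin.succAbove_ne s j) with hlt | hgt
  · rw [gen, if_pos (Nat.succ_lt_succ (Fin.lt_def.1 hlt))]
    rcases lt_or_ge (h (s.succAbove j)) s with hs | hs
    · rw [killVar_g_of_lt (hiff j) hlt hs, gen, if_pos (Nat.succ_lt_succ (ht'.2 ⟨hlt, hs⟩))]
    · rw [killVar_g_of_le (hiff j) hlt hs, gen,
        if_neg fun H => (ht'.1 (Nat.lt_of_succ_lt_succ H)).2.not_ge hs]
  · rw [gen, if_neg fun H => hgt.not_gt (Fin.lt_def.2 (Nat.lt_of_succ_lt_succ H)),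
      killVar_f (hiff j) hgt, gen,
      if_neg fun H => (ht'.1 (Nat.lt_of_succ_lt_succ H)).1.not_gt hgt]

lemma rename_mem_of_mem_idealA
    (hiff : ∀ j l, s.succAbove l ≤ h (s.succAbove j) ↔ l ≤ h' j)
    (ht : ∀ j : Fin n, (j : ℕ) < t ↔ s.succAbove j < s ∧ h (s.succAbove j) < s)
    {q : MvPolynomial (Fin n) ℚ} (hq : q ∈ idealA h' (t + 1)) :
    ∃ r, rename s.succAbove q - X s * r ∈ idealA h (s + 1) := by
  have hle : idealA h' (t + 1) ≤
      (idealA h (s + 1) ⊔ Ideal.span {(X s : MvPolynomial (Fin (n + 1)) ℚ)}).comap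
        (rename s.succAbove) := by
    refine Ideal.span_le.2 ?_
    rintro _ ⟨j, rfl⟩
    change rename s.succAbove (gen h' (t + 1) j) ∈ idealA h (s + 1) ⊔ Ideal.span {X s}
    obtain ⟨r, hr⟩ := exists_eq_rename_killVar_add s (gen h (s + 1) (s.succAbove j))
    rw [killVar_gen hiff ht] at hr
    rw [eq_sub_of_add_eq hr.symm]
    exact sub_mem (Ideal.mem_sup_left (gen_mem_idealA _ _ _)) (Ideal.mem_sup_right
      (Ideal.mul_mem_right _ _ (Ideal.mem_span_singleton_self _)))
  obtain ⟨a, ha, b, hb, hab⟩ := Submodule.mem_sup.1 (hle hq)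
  obtain ⟨r, rfl⟩ := Ideal.mem_span_singleton.1 hb
  exact ⟨r, by rw [← eq_sub_of_add_eq hab]; exact ha⟩

lemma rename_mem_reducedSpan (hh : IsHessenberg h)
    (hval : ∀ j, (h' j : ℕ) =
      if h (s.succAbove j) < s then (h (s.succAbove j) : ℕ) else h (s.succAbove j) - 1)
    (ht : ∀ j : Fin n, (j : ℕ) < t ↔ s.succAbove j < s ∧ h (s.succAbove j) < s)
    {q : MvPolynomial (Fin n) ℚ} (hq : q ∈ reducedSpan ℚ (genDegree h' (t + 1))) :
    rename s.succAbove q ∈ reducedSpan ℚ (genDegree h (s + 1)) := by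
  induction hq using Submodule.span_induction with
  | mem x hx =>
    obtain ⟨β, hβ, rfl⟩ := hx
    rw [rename_monomial]
    refine Submodule.subset_span ⟨_, fun m => ?_, rfl⟩
    rcases Fin.eq_self_or_eq_succAbove s m with rfl | ⟨j, rfl⟩
    · rw [Finsupp.mapDomain_of_notMem_range _ _ (by simp), genDegree, if_neg (lt_irrefl _)]
      exact Nat.succ_pos _
    · rw [Finsupp.mapDomain_apply Fin.succAbove_right_injective]
      refine (hβ j).trans_le (le_of_eq ?_)
      have hle := hh.le_apply (s.succAbove j)
      have htj := ht j
      have hvj := hval j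
      simp only [genDegree, hvj]
      generalize h (s.succAbove j) = i at *
      simp only [Fin.succAbove, Fin.lt_def, Fin.le_def, Fin.val_castSucc, Nat.add_lt_add_iff_right,
        htj] at hle htj ⊢
      split_ifs at hle htj ⊢ <;> simp only [Fin.val_castSucc, Fin.val_succ] at * <;> omega
  | zero => simp
  | add x y _ _ hx hy => rw [map_add]; exact add_mem hx hy
  | smul c x _ hx => rw [map_smul]; exact Submodule.smul_mem _ _ hx

lemma X_mul_mem_reducedSpan {q : MvPolynomial (Fin (n + 1)) ℚ}
    (hq : q ∈ reducedSpan ℚ (genDegree h (s + 2))) :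
    X s * q ∈ reducedSpan ℚ (genDegree h (s + 1)) := by
  induction hq using Submodule.span_induction with
  | mem x hx =>
    obtain ⟨β, hβ, rfl⟩ := hx
    refine Submodule.subset_span ⟨Finsupp.single s 1 + β, fun m => ?_, ?_⟩
    · have := hβ m
      rcases eq_or_ne m s with rfl | hms
      · rw [genDegree, if_pos (by omega)] at this
        rw [genDegree, if_neg (by omega), Finsupp.add_apply, Finsupp.single_eq_same]
        omega
      · have hms' : (m : ℕ) ≠ s := Fin.val_ne_of_ne hms
        rw [Finsupp.add_apply, Finsupp.single_eq_of_ne hms, zero_add]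
        refine this.trans_le (le_of_eq ?_)
        simp only [genDegree]
        congr 1
        exact propext (by omega)
    · rw [X, monomial_mul, one_mul]
  | zero => simp
  | add x y _ _ hx hy => rw [mul_add]; exact add_mem hx hy
  | smul c x _ hx => rw [mul_smul_comm]; exact Submodule.smul_mem _ _ hx

/-- Only the generator with index `s` differs between the two ideals, and `f_{h(s),s}` is
`x_s g_{h(s),s}` modulo the common generators. -/
lemma X_mul_mem_idealA (hh : IsHessenberg h) {q : MvPolynomial (Fin (n + 1)) ℚ}
    (hq : q ∈ idealA h (s + 2)) : X s * q ∈ idealA h (s + 1) := by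
  have hle : idealA h (s + 2) ≤ Submodule.comap
      (LinearMap.mulLeft (MvPolynomial (Fin (n + 1)) ℚ) (X s)) (idealA h (s + 1)) := by
    refine Submodule.span_le.2 ?_
    rintro _ ⟨m, rfl⟩
    change X s * gen h (s + 2) m ∈ idealA h (s + 1)
    have hm := gen_mem_idealA h (s + 1) m
    rcases eq_or_ne m s with rfl | hms
    · have hf := f_sub_X_mul_g_mem hh (J := idealA h (m + 1)) m fun l hl => by
        have := gen_mem_idealA h (m + 1) l
        rwa [gen, if_pos (Nat.succ_lt_succ hl)] at this
      rw [gen, if_neg (lt_irrefl _)] at hm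
      rw [gen, if_pos (by omega)]
      simpa using sub_mem hm hf
    · have hms' : (m : ℕ) ≠ s := Fin.val_ne_of_ne hms
      refine Ideal.mul_mem_left _ _ ?_
      have : gen h (s + 2) m = gen h (s + 1) m := by
        simp only [gen]
        congr 1
        exact propext (by omega)
      rwa [this]
  exact hle hq

/-- The step of the induction: `x_s A_{s+1}^h` and the ring in the remaining variables together
span `A_s^h`. -/
lemma exists_sub_mem_idealA_of_step (hh : IsHessenberg h)
    (hiff : ∀ j l, s.succAbove l ≤ h (s.succAbove j) ↔ l ≤ h' j)
    (hval : ∀ j, (h' j : ℕ) =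
      if h (s.succAbove j) < s then (h (s.succAbove j) : ℕ) else h (s.succAbove j) - 1)
    (ht : ∀ j : Fin n, (j : ℕ) < t ↔ s.succAbove j < s ∧ h (s.succAbove j) < s)
    (ih₁ : ∀ q, ∃ r ∈ reducedSpan ℚ (genDegree h' (t + 1)), q - r ∈ idealA h' (t + 1))
    (ih₂ : ∀ q, ∃ r ∈ reducedSpan ℚ (genDegree h (s + 2)), q - r ∈ idealA h (s + 2))
    (q : MvPolynomial (Fin (n + 1)) ℚ) :
    ∃ r ∈ reducedSpan ℚ (genDegree h (s + 1)), q - r ∈ idealA h (s + 1) := by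
  obtain ⟨a, ha⟩ := exists_eq_rename_killVar_add s q
  obtain ⟨v, hv, hv'⟩ := ih₁ (killVar s q)
  obtain ⟨b, hb⟩ := rename_mem_of_mem_idealA hiff ht hv'
  obtain ⟨w, hw, hw'⟩ := ih₂ (a + b)
  refine ⟨rename s.succAbove v + X s * w, add_mem (rename_mem_reducedSpan hh hval ht hv)
    (X_mul_mem_reducedSpan hw), ?_⟩
  have hsum := add_mem hb (X_mul_mem_idealA hh hw')
  rw [map_sub] at hsum
  convert hsum using 1
  linear_combination ha

/-- The reduced monomials span `A_s^h`. There is no condition on `s`: if `h(m) = m` for some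
`m < s`, then `A_s^h` is zero. -/
lemma exists_sub_mem_idealA (n : ℕ) : ∀ h : Fin n → Fin n, IsHessenberg h → ∀ s q,
    ∃ r ∈ reducedSpan ℚ (genDegree h (s + 1)), q - r ∈ idealA h (s + 1) := by
  induction n with
  | zero =>
    intro h _ s q
    refine ⟨q, ?_, by rw [sub_self]; exact zero_mem _⟩
    have hq : q = coeff 0 q • monomial 0 1 := by
      rw [smul_monomial, smul_eq_mul, mul_one]
      exact eq_C_of_isEmpty q
    rw [hq]
    exact Submodule.smul_mem _ _ (Submodule.subset_span ⟨0, fun m => m.elim0, rfl⟩)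
  | succ n ihn =>
    intro h hh s
    -- Downward induction on `s`: for `s > n` the last generator is a unit.
    induction hk : n + 1 - s generalizing s with
    | zero =>
      intro q
      have hlast : h (Fin.last n) = Fin.last n := le_antisymm (Fin.le_last _) (hh.le_apply _)
      refine ⟨0, zero_mem _, ?_⟩
      rw [idealA_eq_top (m := Fin.last n) (by rw [Fin.val_last]; omega) hlast]
      exact Submodule.mem_top
    | succ k ihk =>
      obtain ⟨s, rfl⟩ : ∃ s' : Fin (n + 1), (s' : ℕ) = s := ⟨⟨s, by omega⟩, rfl⟩
      obtain ⟨h', hh', hval, hiff⟩ := exists_delete hh s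
      obtain ⟨t, ht⟩ := exists_bound_of_isLowerSet
        (P := fun j => s.succAbove j < s ∧ h (s.succAbove j) < s) fun j l hjl hl => by
          have hle := Fin.succAbove_le_succAbove_iff (p := s).2 hjl
          exact ⟨hle.trans_lt hl.1, (hh.mono hle).trans_lt hl.2⟩
      exact exists_sub_mem_idealA_of_step hh hiff hval ht (ihn h' hh' t)
        (ihk (s + 1) (by omega))

end Spanning

/-! ### The monomial basis -/

section MonomialBasis

variable {n : ℕ}

lemma isHomogeneous_f {i j : Fin n} : (f i j).IsHomogeneous ((i : ℕ) - j + 1) := by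
  refine IsHomogeneous.sum _ _ _ fun k _ => IsHomogeneous.mul ?_ (isHomogeneous_X _ _)
  have := IsHomogeneous.prod (Finset.Ioc j i) (fun l => (X k - X l : MvPolynomial (Fin n) ℚ))
    (fun _ => 1) fun l _ => (isHomogeneous_X _ _).sub (isHomogeneous_X _ _)
  rwa [Finset.sum_const, Fin.card_Ioc, smul_eq_mul, mul_one] at this

lemma isHomogeneous_g {i j : Fin n} : (g i j).IsHomogeneous ((i : ℕ) - j) := by
  refine IsHomogeneous.sum _ _ _ fun k _ => ?_
  have := IsHomogeneous.prod (Finset.Ioc j i) (fun l => (X k - X l : MvPolynomial (Fin n) ℚ))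
    (fun _ => 1) fun l _ => (isHomogeneous_X _ _).sub (isHomogeneous_X _ _)
  rwa [Finset.sum_const, Fin.card_Ioc, smul_eq_mul, mul_one] at this

lemma isHomogeneous_gen (h : Fin n → Fin n) (s : ℕ) (m : Fin n) :
    (gen h s m).IsHomogeneous (genDegree h s m) := by
  rw [gen, genDegree]
  split_ifs
  · exact isHomogeneous_g
  · exact isHomogeneous_f

lemma genDegree_pos {h : Fin n → Fin n} (hh : IsHessenberg h) {s : ℕ} (hs : s ≤ p h) (m : Fin n) :
    0 < genDegree h s m := by
  rw [genDegree]
  split_ifs with hms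
  · have hne : h m ≠ m := fun hm => by
      have : p h ≤ (m : ℕ) + 1 := Nat.sInf_le ⟨m, hm, rfl⟩
      omega
    have hlt := Fin.lt_def.1 (lt_of_le_of_ne (hh.le_apply m) hne.symm)
    omega
  · exact Nat.succ_pos _

lemma mem_exponents_iff {h : Fin n → Fin n} (hh : IsHessenberg h) {s : ℕ} {e : Fin n → ℕ} :
    e ∈ exponents h s ↔ ∀ m, e m < genDegree h s m := by
  refine forall_congr' fun m => ?_
  have hle := Fin.le_def.1 (hh.le_apply m)
  rw [genDegree]
  split_ifs <;> omega

lemma xpow_eq_monomial (e : Fin n → ℕ) :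
    xpow e = monomial (Finsupp.equivFunOnFinite.symm e) 1 := by
  rw [monomial_eq, Finsupp.prod_fintype _ _ (by simp), C_1, one_mul]
  rfl

lemma span_range_xpow {h : Fin n → Fin n} (hh : IsHessenberg h) (s : ℕ) :
    Submodule.span ℚ (Set.range fun e : exponents h s => xpow e.1) =
      reducedSpan ℚ (genDegree h s) := by
  rw [reducedSpan]
  congr 1
  ext q
  constructor
  · rintro ⟨e, rfl⟩
    exact ⟨_, (mem_exponents_iff hh).1 e.2, xpow_eq_monomial _⟩
  · rintro ⟨β, hβ, rfl⟩
    refine ⟨⟨β, (mem_exponents_iff hh).2 hβ⟩, ?_⟩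
    simp only [xpow_eq_monomial, Finsupp.equivFunOnFinite_symm_coe]

lemma linearIndependent_xpow (S : Set (Fin n → ℕ)) :
    LinearIndependent ℚ fun e : S => xpow e.1 := by
  have := (basisMonomials (Fin n) ℚ).linearIndependent.comp
    (fun e : S => Finsupp.equivFunOnFinite.symm e.1)
    (Finsupp.equivFunOnFinite.symm.injective.comp Subtype.val_injective)
  rw [coe_basisMonomials] at this
  simp only [xpow_eq_monomial]
  exact this

theorem exists_basis_A {h : Fin n → Fin n} (hh : IsHessenberg h) {s : ℕ} (hs₁ : 1 ≤ s)
    (hs : s ≤ p h) : ∃ b : Module.Basis (exponents h s) ℚ (A h s),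
      ∀ e : exponents h s, b e = Ideal.Quotient.mk (idealA h s) (xpow e.1) := by
  have hspan : ∀ q : MvPolynomial (Fin n) ℚ,
      ∃ r ∈ reducedSpan ℚ (genDegree h s), q - r ∈ idealA h s := by
    obtain ⟨t, rfl⟩ := Nat.exists_eq_succ_of_ne_zero (Nat.one_le_iff_ne_zero.1 hs₁)
    exact exists_sub_mem_idealA n h hh t
  let π : MvPolynomial (Fin n) ℚ →ₗ[ℚ] A h s := (Ideal.Quotient.mkₐ ℚ (idealA h s)).toLinearMap
  have hπ (q : MvPolynomial (Fin n) ℚ) : π q = Ideal.Quotient.mk (idealA h s) q := rfl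
  have hli : LinearIndependent ℚ fun e : exponents h s => π (xpow e.1) := by
    refine (linearIndependent_xpow _).map (f := π) (Submodule.disjoint_def.2 fun q hq hq0 => ?_)
    rw [span_range_xpow hh] at hq
    exact eq_zero_of_mem_reducedSpan_of_mem_ideal (genDegree_pos hh hs) (isHomogeneous_gen h s)
      hspan hq (Ideal.Quotient.eq_zero_iff_mem.1 hq0)
  have htop : ⊤ ≤ Submodule.span ℚ (Set.range fun e : exponents h s => π (xpow e.1)) := by
    intro a _
    obtain ⟨q, rfl⟩ := Ideal.Quotient.mk_surjective a
    obtain ⟨r, hr, hqr⟩ := hspan q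
    rw [Ideal.Quotient.eq.2 hqr, ← hπ]
    rw [← span_range_xpow hh] at hr
    have := Submodule.mem_map_of_mem (f := π) hr
    rwa [Submodule.map_span, ← Set.range_comp] at this
  exact ⟨Module.Basis.mk hli htop, fun e => by rw [Module.Basis.mk_apply, hπ]⟩

lemma idealA_one (h : Fin n → Fin n) : idealA h 1 = idealI h := by
  simp [idealA, idealI]

lemma one_le_p {h : Fin n → Fin n} (hn : 0 < n) (hh : IsHessenberg h) : 1 ≤ p h := by
  have hne : {k : ℕ | ∃ m : Fin n, h m = m ∧ k = (m : ℕ) + 1}.Nonempty := by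
    refine ⟨_, ⟨n - 1, by omega⟩, le_antisymm ?_ (hh.le_apply _), rfl⟩
    rw [Fin.le_def]
    exact Nat.le_sub_one_of_lt (Fin.isLt _)
  obtain ⟨m, _, hm⟩ := Nat.sInf_mem hne
  rw [p, hm]
  exact Nat.succ_pos _

end MonomialBasis

end Hessenberg

theorem mainTheorem2 (n : ℕ) (hn : 0 < n) (h : Fin n → Fin n) (hh : Hessenberg.IsHessenberg h) :
    (∀ s : ℕ, 1 ≤ s → s ≤ Hessenberg.p h →
      ∃ b : Module.Basis (Hessenberg.exponents h s) ℚ (Hessenberg.A h s),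
        ∀ e : Hessenberg.exponents h s,
          b e = Ideal.Quotient.mk (Hessenberg.idealA h s) (Hessenberg.xpow e.1)) ∧
    (∃ b : Module.Basis
        {e : Fin n → ℕ // ∀ m : Fin n, (e m : ℤ) ≤ ((h m : ℕ) : ℤ) - ((m : ℕ) : ℤ)}
        ℚ (MvPolynomial (Fin n) ℚ ⧸ Hessenberg.idealI h),
      ∀ e, b e = Ideal.Quotient.mk (Hessenberg.idealI h) (Hessenberg.xpow e.1)) := by
  refine ⟨fun s hs₁ hs => Hessenberg.exists_basis_A hh hs₁ hs, ?_⟩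
  obtain ⟨b, hb⟩ := Hessenberg.exists_basis_A hh le_rfl (Hessenberg.one_le_p hn hh)
  unfold Hessenberg.A at b
  rw [← Hessenberg.idealA_one]
  have hexp (e : Fin n → ℕ) : e ∈ Hessenberg.exponents h 1 ↔
      ∀ m : Fin n, (e m : ℤ) ≤ ((h m : ℕ) : ℤ) - ((m : ℕ) : ℤ) := by
    exact forall_congr' fun m => ⟨fun H => H.2 (by omega), fun H => ⟨fun hm => by omega, fun _ => H⟩⟩
  refine ⟨b.reindex (Equiv.subtypeEquivRight hexp), fun e => ?_⟩
  rw [Module.Basis.reindex_apply, hb]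
  rfl
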